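/- Let $0<q<1$, $a>0$, and let $n,N$ be integers with $1\le n\le N-1$. Write $(c;q)_k=\prod_{j=0}^{k-1}(1-cq^j)$ and, for $s\in\mathbb{R}$, let $x(s)=\tfrac12(q^s+q^{-s})$ be the $q$-quadratic grid. For $\alpha>-1$ and $-1<\beta<2a$ let the $q$-Racah polynomial $R_n^{(\alpha,\beta)}(\cdot;q)$ be the polynomial such that, for all $s\in\mathbb{R}$, $$ R_n^{(\alpha,\beta)}(x(s);q)={}_4\phi_3\!\left(\begin{matrix}q^{-n},\,q^{\alpha+\beta+n+1},\,q^{a-s},\,q^{s+a}\\ q^{2a+\alpha+N},\,q^{\beta+1},\,q^{1-N}\end{matrix};q,q\right)=\sum_{k=0}^{n}\frac{(q^{-n};q)_k\,(q^{\alpha+\beta+n+1};q)_k\,(q^{a-s};q)_k\,(q^{s+a};q)_k}{(q^{2a+\alpha+N};q)_k\,(q^{\beta+1};q)_k\,(q^{1-N};q)_k}\,\frac{q^k}{(q;q)_k}. $$ Then $R_n^{(\alpha,\beta)}(\cdot;q)$ has degree $n$ and its zeros are real and simple; denote them by $Y_1(\alpha,\beta)<\dots<Y_n(\alpha,\beta)$.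 For every $k=1,\dots,n$ the following holds. (i) If $a\ge 1/2$, then $\alpha\mapsto Y_k(\alpha,\beta)$ is strictly decreasing on $(-1,\infty)$ for each fixed $\beta\in(-1,2a)$, and $\beta\mapsto Y_k(\alpha,\beta)$ is strictly increasing on $(-1,2a)$ for each fixed $\alpha\in(-1,\infty)$. (ii) If $0<a<1/2$, then $\alpha\mapsto Y_k(\alpha,\beta)$ is strictly decreasing on $(-1,\infty)$ for each fixed $\beta\in(a-\tfrac12,2a)$, and $\beta\mapsto Y_k(\alpha,\beta)$ is strictly increasing on $(a-\tfrac12,2a)$ for each fixed $\alpha\in(-1,\infty)$. -/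

import Mathlib

noncomputable section

/-- The `q`-shifted factorial `(c; q)_k = ∏_{j < k} (1 - c q^j)`. -/
def qPochhammer (c q : ℝ) (k : ℕ) : ℝ :=
  ∏ j ∈ Finset.range k, (1 - c * q ^ j)

/-- The basic hypergeometric series with numerator parameters `as`, denominator parameters `bs`,
base `q` and argument `z`. If some numerator parameter is `q ^ (-n)`, then all terms with `k > n`
are zero, also when a denominator vanishes there, so that the series terminates. -/
def basicHypergeometric (as bs : List ℝ) (q z : ℝ) : ℝ :=
  ∑' k : ℕ, (as.map fun c => qPochhammer c q k).prod / (bs.map fun c => qPochhammer c q k).prod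
    * ((-1) ^ k * q ^ (k.choose 2)) ^ (1 + (bs.length : ℤ) - (as.length : ℤ))
    * (z ^ k / qPochhammer q q k)

/-- The `q`-quadratic grid `x(s) = (q^s + q^{-s}) / 2`. -/
def qQuadraticGrid (q s : ℝ) : ℝ := (q ^ s + q ^ (-s)) / 2

/-- The `q`-Racah function
`₄φ₃(q^{-n}, q^{α+β+n+1}, q^{a-s}, q^{s+a}; q^{2a+α+N}, q^{β+1}, q^{1-N}; q, q)`. -/
def qRacahSeries (n N : ℕ) (a α β q s : ℝ) : ℝ :=
  basicHypergeometric
    [q ^ (-(n : ℝ)), q ^ (α + β + n + 1), q ^ (a - s), q ^ (s + a)]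
    [q ^ (2 * a + α + N), q ^ (β + 1), q ^ (1 - (N : ℝ))] q q

open Polynomial in
/-- The `q`-Racah polynomial `R_n^{(α,β)}(X; q)`: the polynomial in `X` whose value at `X = x(s)` is
`qRacahSeries n N a α β q s` for every real `s`, see `qRacah_eval_qQuadraticGrid`. It is obtained by
writing `(q^{a-s}; q)_k (q^{s+a}; q)_k = ∏_{j < k} (1 - 2 q^{a+j} x(s) + q^{2(a+j)})`. -/
def qRacah (n N : ℕ) (a α β q : ℝ) : ℝ[X] :=
  ∑ k ∈ Finset.range (n + 1),
    C (qPochhammer (q ^ (-(n : ℝ))) q k * qPochhammer (q ^ (α + β + n + 1)) q k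
        / (qPochhammer (q ^ (2 * a + α + N)) q k * qPochhammer (q ^ (β + 1)) q k
            * qPochhammer (q ^ (1 - (N : ℝ))) q k)
        * (q ^ k / qPochhammer q q k))
      * ∏ j ∈ Finset.range k, (1 - C (2 * q ^ (a + j)) * X + C (q ^ (2 * (a + j))))

theorem qPochhammer_grid {q : ℝ} (hq : 0 < q) (a s : ℝ) (k : ℕ) :
    qPochhammer (q ^ (a - s)) q k * qPochhammer (q ^ (s + a)) q k =
      ∏ j ∈ Finset.range k,
        (1 - 2 * q ^ (a + j) * qQuadraticGrid q s + q ^ (2 * (a + j))) := by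
  unfold qPochhammer
  rw [← Finset.prod_mul_distrib]
  refine Finset.prod_congr rfl fun j _ => ?_
  have h1 : q ^ (a - s) = q ^ a * q ^ (-s) := by rw [← Real.rpow_add hq, sub_eq_add_neg]
  have h2 : q ^ (s + a) = q ^ s * q ^ a := Real.rpow_add hq _ _
  have h3 : q ^ (a + (j : ℝ)) = q ^ a * q ^ j := by rw [Real.rpow_add hq, Real.rpow_natCast]
  have h4 : q ^ (2 * (a + (j : ℝ))) = (q ^ a * q ^ j) ^ 2 := by
    rw [two_mul, Real.rpow_add hq, h3, sq]
  have h5 : q ^ s * q ^ (-s) = 1 := by rw [← Real.rpow_add hq, add_neg_cancel, Real.rpow_zero]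
  rw [h1, h2, h3, h4, qQuadraticGrid]
  linear_combination (q ^ a * q ^ j) ^ 2 * h5

theorem qPochhammer_rpow_neg_eq_zero {q : ℝ} (hq : 0 < q) {n k : ℕ} (h : n < k) :
    qPochhammer (q ^ (-(n : ℝ))) q k = 0 := by
  refine Finset.prod_eq_zero (Finset.mem_range.2 h) ?_
  rw [← Real.rpow_natCast, ← Real.rpow_add hq, neg_add_cancel, Real.rpow_zero, sub_self]

/-- On the grid, the polynomial `qRacah` is the `₄φ₃` series. -/
theorem qRacah_eval_qQuadraticGrid {q : ℝ} (hq : 0 < q) (n N : ℕ) (a α β s : ℝ) :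
    (qRacah n N a α β q).eval (qQuadraticGrid q s) = qRacahSeries n N a α β q s := by
  unfold qRacahSeries basicHypergeometric
  rw [tsum_eq_sum (s := Finset.range (n + 1))]
  · rw [qRacah, Polynomial.eval_finsetSum]
    refine Finset.sum_congr rfl fun k _ => ?_
    simp only [Polynomial.eval_mul, Polynomial.eval_C, Polynomial.eval_prod, Polynomial.eval_add,
      Polynomial.eval_sub, Polynomial.eval_one, Polynomial.eval_X]
    rw [← qPochhammer_grid hq]
    simp
    ring
  · intro k hk
    have : n < k := by simpa using hk
    simp only [List.map_cons, List.prod_cons, qPochhammer_rpow_neg_eq_zero hq this, zero_mul, zero_div]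

end

/-! The engine is Markov's principle: if two positive weights on the same points have a ratio w₂/w₁
that increases with x, then every zero of the n-th orthogonal polynomial for w₂ exceeds the
corresponding zero for w₁ (`root_lt_root_of_ratio_lt`). What remains is to find the weights and to
compare them.

Put G = q^{2a}, A = q^β, b = q^α, M = q^N, z = q^i. On the lattice s = a + i, 0 ≤ i < N, the q-Racah
polynomial is an eigenvector of a second-order difference operator that is bidiagonal on the
products φ_k = (1/z; q)_k (Gz; q)_k (`RacahParams.operator_eigen`). Detailed balance, w(i+1)/w(i) =
up(q^i)/down(q^{i+1}), defines weights for which the operator is symmetric. They are positive for α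
> -1 and -1 < β < 2a, and the eigenvalues are distinct, so the polynomials are orthogonal
(`qRacah_orthogonal`) and their zeros are real and simple.

The quotient w(i+1)/w(i) is a Möbius function of A and of b separately, with determinant a multiple
of 1 - G q^{2i+1} > 0. It decreases in A and increases in b (`cross_lt_of_A_lt`,
`cross_lt_of_b_lt`). Since 0 < q < 1, A falls as β grows and b falls as α grows, which gives the two
opposite monotonicities. -/

/-! ### Orthogonal polynomials of a discrete measure: zeros, Gauss quadrature, Markov's theorem -/

open Polynomial in
-- If p = u h, orthogonality to h makes the sum of w u h² vanish. All its terms are nonnegative, so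
-- p vanishes on the whole support, which has more points than the degree of p.
theorem not_dvd_of_orthogonal {ι : Type*} {s : Finset ι} {x w : ι → ℝ} (hx : Set.InjOn x s)
    (hw : ∀ i ∈ s, 0 < w i) {p : ℝ[X]} (hp : p ≠ 0) (hs : p.natDegree < s.card)
    (horth : ∀ h : ℝ[X], h.degree < p.degree → ∑ i ∈ s, w i * (p * h).eval (x i) = 0)
    {u : ℝ[X]} (hu : 0 < u.degree) (hu0 : ∀ t, 0 ≤ u.eval t) : ¬ u ∣ p := by
  rintro ⟨h, rfl⟩
  have hh : h ≠ 0 := right_ne_zero_of_mul hp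
  have hdeg : h.degree < (u * h).degree := by
    have hu' : u ≠ 0 := left_ne_zero_of_mul hp
    rw [degree_mul, degree_eq_natDegree hh, degree_eq_natDegree hu']
    rw [degree_eq_natDegree hu'] at hu
    norm_cast at hu ⊢
    omega
  have hsum := horth h hdeg
  rw [Finset.sum_eq_zero_iff_of_nonneg] at hsum
  · refine hp (eq_zero_of_natDegree_lt_card_of_eval_eq_zero' _ (s.image x) ?_ ?_)
    · intro t ht
      obtain ⟨i, hi, rfl⟩ := Finset.mem_image.1 ht
      have := hsum i hi
      rw [eval_mul] at this
      rcases mul_eq_zero.1 this with h1 | h1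
      · exact absurd h1 (hw i hi).ne'
      · rcases mul_eq_zero.1 h1 with h2 | h2
        · exact h2
        · rw [eval_mul, h2, mul_zero]
    · rwa [Finset.card_image_of_injOn hx]
  · intro i hi
    rw [eval_mul, eval_mul, mul_assoc]
    exact mul_nonneg (hw i hi).le (mul_nonneg (hu0 _) (mul_self_nonneg _))

open Polynomial in
-- A nonreal zero z would give the divisor (t - Re z)² + (Im z)², a multiple zero the square of a
-- nonunit. Both are nonnegative on ℝ and excluded by `not_dvd_of_orthogonal`.
theorem exists_strictMono_roots_of_orthogonal {ι : Type*} {s : Finset ι} {x w : ι → ℝ}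
    (hx : Set.InjOn x s) (hw : ∀ i ∈ s, 0 < w i) {p : ℝ[X]} {n : ℕ} (hp : p ≠ 0)
    (hn : p.natDegree = n) (hs : n < s.card)
    (horth : ∀ h : ℝ[X], h.degree < n → ∑ i ∈ s, w i * (p * h).eval (x i) = 0) :
    ∃ y : Fin n → ℝ, StrictMono y ∧ p = C p.leadingCoeff * ∏ k, (X - C (y k)) := by
  have key : ∀ u : ℝ[X], 0 < u.degree → (∀ t, 0 ≤ u.eval t) → ¬ u ∣ p := fun u hu hu0 =>
    not_dvd_of_orthogonal hx hw hp (hn ▸ hs)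
      (fun h hh => horth h (by rwa [degree_eq_natDegree hp, hn] at hh)) hu hu0
  have hsplit : p.Splits := by
    obtain ⟨v, hv⟩ := UniqueFactorizationMonoid.factors_prod hp
    rw [← hv]
    refine (Splits.multisetProd fun g hgmem => Splits.of_degree_eq_one ?_).mul v.isUnit.splits
    have hg := UniqueFactorizationMonoid.irreducible_of_factor g hgmem
    have hgp := UniqueFactorizationMonoid.dvd_of_mem_factors hgmem
    have hg0 : 0 < g.degree := degree_pos_of_irreducible hg
    obtain ⟨z, hz⟩ := Complex.exists_root (f := g.map (algebraMap ℝ ℂ))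
      (by rwa [degree_map])
    have hz' : aeval z g = 0 := by rwa [IsRoot.def, eval_map_algebraMap] at hz
    by_cases him : z.im = 0
    · have hre : g.IsRoot z.re := by
        have hzr : z = algebraMap ℝ ℂ z.re := by
          apply Complex.ext <;> simp [him]
        rw [hzr, aeval_algebraMap_apply] at hz'
        simpa using hz'
      exact degree_eq_one_of_irreducible_of_root hg hre
    · have hd := quadratic_dvd_of_aeval_eq_zero_im_ne_zero g hz' him
      refine absurd (hd.trans hgp) (key _ ?_ fun t => ?_)
      · have : (X ^ 2 - C (2 * z.re) * X + C (‖z‖ ^ 2) : ℝ[X]).degree = 2 := by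
          compute_degree!
        rw [this]; norm_num
      · have h1 : ‖z‖ ^ 2 = z.re ^ 2 + z.im ^ 2 := by
          rw [← Complex.normSq_eq_norm_sq, Complex.normSq_apply]; ring
        simp only [eval_add, eval_sub, eval_pow, eval_X, eval_mul, eval_C, h1]
        nlinarith [sq_nonneg (t - z.re), sq_nonneg z.im]
  have hnodup : p.roots.Nodup := by
    rw [nodup_roots_iff_of_splits hp hsplit]
    rw [PerfectField.separable_iff_squarefree]
    intro u hu
    by_contra hunit
    have hu0 : u ≠ 0 := by rintro rfl; exact hp (by simpa using hu)
    refine key (u * u) ?_ (fun t => by rw [eval_mul]; exact mul_self_nonneg _) hu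
    have := degree_pos_of_ne_zero_of_nonunit hu0 hunit
    rw [degree_mul]
    exact this.trans_le (le_add_of_nonneg_right this.le)
  have hcard : p.roots.toFinset.card = n := by
    rw [Multiset.toFinset_card_of_nodup hnodup, ← hn, hsplit.natDegree_eq_card_roots]
  refine ⟨p.roots.toFinset.orderEmbOfFin hcard, OrderEmbedding.strictMono _, ?_⟩
  conv_lhs => rw [hsplit.eq_prod_roots]
  congr 1
  have h1 : (p.roots.map fun a => X - C a).prod = ∏ a ∈ p.roots.toFinset, (X - C a) := by
    rw [Finset.prod_multiset_map_count]
    refine Finset.prod_congr rfl fun a ha => ?_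
    rw [Multiset.count_eq_one_of_mem hnodup (Multiset.mem_toFinset.1 ha), pow_one]
  rw [h1]
  conv_lhs => rw [← Finset.map_orderEmbOfFin_univ _ hcard]
  rw [Finset.prod_map]
  rfl

open Polynomial in
/-- Gauss quadrature for a discrete measure. -/
theorem exists_gauss_quadrature {ι : Type*} {s : Finset ι} {x w : ι → ℝ}
    (hw : ∀ i ∈ s, 0 < w i) {p : ℝ[X]} {n : ℕ} {c : ℝ} {y : Fin n → ℝ} (hc : c ≠ 0)
    (hy : Function.Injective y) (hpy : p = C c * ∏ k, (X - C (y k)))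
    (horth : ∀ h : ℝ[X], h.degree < n → ∑ i ∈ s, w i * (p * h).eval (x i) = 0) :
    ∃ l : Fin n → ℝ, (∀ k, 0 ≤ l k) ∧ ∀ h : ℝ[X], h.degree < ((2 * n : ℕ) : WithBot ℕ) →
      ∑ i ∈ s, w i * h.eval (x i) = ∑ k, l k * h.eval (y k) := by
  set P : ℝ[X] := ∏ k, (X - C (y k)) with hP
  have hmonic : P.Monic := monic_prod_of_monic _ _ fun k _ => monic_X_sub_C _
  have hPdeg : P.degree = n := by
    rw [hP, degree_prod]; simp
  have hPorth : ∀ h : ℝ[X], h.degree < n → ∑ i ∈ s, w i * (P * h).eval (x i) = 0 := by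
    intro h hh
    have := horth h hh
    simp only [hpy, mul_assoc (C c), eval_mul (p := C c), eval_C, mul_left_comm _ c] at this
    rw [← Finset.mul_sum] at this
    exact (mul_eq_zero.1 this).resolve_left hc
  have hroot : ∀ k, P.eval (y k) = 0 := fun k => by
    rw [hP, eval_prod]; exact Finset.prod_eq_zero (Finset.mem_univ k) (by simp)
  have hinj : Set.InjOn y (Finset.univ : Finset (Fin n)) := hy.injOn
  -- Interpolation at the zeros makes these weights exact in degree below n. Division by `P` extends
  -- this to degree below 2n, because the quotient has degree below n and is orthogonal to `P`.
  set l : Fin n → ℝ := fun k => ∑ i ∈ s, w i * (Lagrange.basis Finset.univ y k).eval (x i)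
  have hquad : ∀ h : ℝ[X], h.degree < ((2 * n : ℕ) : WithBot ℕ) →
      ∑ i ∈ s, w i * h.eval (x i) = ∑ k, l k * h.eval (y k) := by
    intro h hh
    have hdiv := modByMonic_add_div h P
    have hrdeg : (h %ₘ P).degree < (Finset.univ : Finset (Fin n)).card := by
      rw [Finset.card_univ, Fintype.card_fin, ← hPdeg]; exact degree_modByMonic_lt _ hmonic
    have hqdeg : (h /ₘ P).degree < n := by
      by_cases h0 : h /ₘ P = 0
      · rw [h0, degree_zero]; exact WithBot.bot_lt_coe n
      have hle : P.degree ≤ h.degree := by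
        by_contra hlt
        exact h0 ((divByMonic_eq_zero_iff hmonic).2 (not_le.1 hlt))
      have := degree_add_divByMonic hmonic hle
      have hne : h ≠ 0 := by rintro rfl; simp at h0
      rw [hPdeg, degree_eq_natDegree h0, degree_eq_natDegree hne] at this
      rw [degree_eq_natDegree hne] at hh
      rw [degree_eq_natDegree h0]
      norm_cast at this hh ⊢
      omega
    have heval : ∀ k, h.eval (y k) = (h %ₘ P).eval (y k) := fun k => by
      conv_lhs => rw [← hdiv]
      simp [hroot]
    have hr := Lagrange.eq_interpolate hinj hrdeg
    calc ∑ i ∈ s, w i * h.eval (x i)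
        = ∑ i ∈ s, w i * (h %ₘ P).eval (x i) + ∑ i ∈ s, w i * (P * (h /ₘ P)).eval (x i) := by
          rw [← Finset.sum_add_distrib]
          refine Finset.sum_congr rfl fun i _ => ?_
          conv_lhs => rw [← hdiv]
          rw [eval_add, mul_add]
      _ = ∑ i ∈ s, w i * (h %ₘ P).eval (x i) := by rw [hPorth _ hqdeg, add_zero]
      _ = ∑ i ∈ s, ∑ k, w i * (Lagrange.basis Finset.univ y k).eval (x i) * h.eval (y k) := by
          refine Finset.sum_congr rfl fun i _ => ?_
          conv_lhs => rw [hr]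
          rw [Lagrange.interpolate_apply, eval_finsetSum, Finset.mul_sum]
          refine Finset.sum_congr rfl fun k _ => ?_
          rw [eval_mul, eval_C, heval]; ring
      _ = _ := by
          rw [Finset.sum_comm]
          refine Finset.sum_congr rfl fun k _ => ?_
          rw [Finset.sum_mul]
  refine ⟨l, fun k => ?_, hquad⟩
  have hb : (Lagrange.basis Finset.univ y k).degree = ((n - 1 : ℕ) : WithBot ℕ) := by
    rw [Lagrange.degree_basis hinj (Finset.mem_univ k)]; simp
  have hk := k.pos
  -- The square of a Lagrange basis polynomial has degree 2n - 2, so the quadrature applies and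
  -- expresses `l k` as a sum of nonnegative terms.
  have h2 := hquad (Lagrange.basis Finset.univ y k * Lagrange.basis Finset.univ y k) (by
    rw [degree_mul, hb]; norm_cast; omega)
  rw [Finset.sum_eq_single k] at h2
  · rw [eval_mul, Lagrange.eval_basis_self hinj (Finset.mem_univ k), mul_one, mul_one] at h2
    rw [← h2]
    refine Finset.sum_nonneg fun i hi => mul_nonneg (hw i hi).le ?_
    rw [eval_mul]; exact mul_self_nonneg _
  · intro j _ hj
    rw [eval_mul, Lagrange.eval_basis_of_ne (Ne.symm hj) (Finset.mem_univ j)]; ring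
  · simp

open Polynomial in
/-- Markov's theorem on the monotonicity of zeros, for two discrete measures with the same support
whose density ratio is strictly increasing. -/
theorem root_lt_root_of_ratio_lt {ι : Type*} {s : Finset ι} {x w₁ w₂ : ι → ℝ}
    (hx : Set.InjOn x s) (hw₁ : ∀ i ∈ s, 0 < w₁ i) (hw₂ : ∀ i ∈ s, 0 < w₂ i)
    (hratio : ∀ i ∈ s, ∀ j ∈ s, x i < x j → w₁ j * w₂ i < w₁ i * w₂ j)
    {p₁ p₂ : ℝ[X]} {n : ℕ} {c₁ c₂ : ℝ} {y₁ y₂ : Fin n → ℝ} (hs : n < s.card)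
    (hc₁ : c₁ ≠ 0) (hc₂ : c₂ ≠ 0) (hy₁ : StrictMono y₁) (hy₂ : StrictMono y₂)
    (hp₁ : p₁ = C c₁ * ∏ k, (X - C (y₁ k))) (hp₂ : p₂ = C c₂ * ∏ k, (X - C (y₂ k)))
    (horth₁ : ∀ h : ℝ[X], h.degree < n → ∑ i ∈ s, w₁ i * (p₁ * h).eval (x i) = 0)
    (horth₂ : ∀ h : ℝ[X], h.degree < n → ∑ i ∈ s, w₂ i * (p₂ * h).eval (x i) = 0)
    (k : Fin n) : y₁ k < y₂ k := by
  obtain ⟨l₁, hl₁, hq₁⟩ := exists_gauss_quadrature hw₁ hc₁ hy₁.injective hp₁ horth₁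
  obtain ⟨l₂, hl₂, hq₂⟩ := exists_gauss_quadrature hw₂ hc₂ hy₂.injective hp₂ horth₂
  -- `f` vanishes at `y₁ j` for j < k and at `y₂ j` for j > k. In the first quadrature only nodes ≥
  -- `y₁ k` survive, in the second only nodes ≤ `y₂ k`, so the sums of (x - y k) f² have known
  -- signs.
  set z : Fin n → ℝ := fun j => if j < k then y₁ j else y₂ j
  set f : ℝ[X] := ∏ j ∈ Finset.univ.erase k, (X - C (z j)) with hf
  have hfmonic : f.Monic := monic_prod_of_monic _ _ fun k _ => monic_X_sub_C _
  have hfdeg : f.natDegree = n - 1 := by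
    rw [hf, natDegree_prod _ _ fun j _ => X_sub_C_ne_zero _]; simp
  have hfroot : ∀ j, j ≠ k → f.eval (z j) = 0 := fun j hj => by
    rw [hf, eval_prod]
    exact Finset.prod_eq_zero (Finset.mem_erase.2 ⟨hj, Finset.mem_univ j⟩) (by simp)
  have hk := k.pos
  have hdeg : ∀ t : ℝ, ((X - C t) * (f * f)).degree < ((2 * n : ℕ) : WithBot ℕ) := fun t => by
    rw [degree_mul, degree_mul, degree_X_sub_C, degree_eq_natDegree hfmonic.ne_zero, hfdeg]
    norm_cast
    omega
  have h₁ : 0 ≤ ∑ i ∈ s, w₁ i * ((X - C (y₁ k)) * (f * f)).eval (x i) := by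
    rw [hq₁ _ (hdeg _)]
    refine Finset.sum_nonneg fun j _ => ?_
    by_cases hj : j < k
    · have := hfroot j hj.ne
      simp only [z, if_pos hj] at this
      simp [this]
    · rw [eval_mul, eval_mul]
      refine mul_nonneg (hl₁ j) (mul_nonneg ?_ (mul_self_nonneg _))
      simpa using hy₁.monotone (not_lt.1 hj)
  have h₂ : ∑ i ∈ s, w₂ i * ((X - C (y₂ k)) * (f * f)).eval (x i) ≤ 0 := by
    rw [hq₂ _ (hdeg _)]
    refine Finset.sum_nonpos fun j _ => ?_
    by_cases hj : k < j
    · have := hfroot j hj.ne'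
      simp only [z, if_neg hj.not_gt] at this
      simp [this]
    · rw [eval_mul, eval_mul]
      refine mul_nonpos_of_nonneg_of_nonpos (hl₂ j)
        (mul_nonpos_of_nonpos_of_nonneg ?_ (mul_self_nonneg _))
      simpa using hy₂.monotone (not_lt.1 hj)
  -- two points of the support at which `f` does not vanish
  obtain ⟨i₀, hi₀, j₀, hj₀, hij, hfi, hfj⟩ : ∃ i ∈ s, ∃ j ∈ s, x i < x j ∧
      f.eval (x i) ≠ 0 ∧ f.eval (x j) ≠ 0 := by
    classical
    -- The support has at least n + 1 points and `f` at most n - 1 roots.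
    have hcard : 1 < (s.image x \ f.roots.toFinset).card := by
      have e1 := Finset.le_card_sdiff f.roots.toFinset (s.image x)
      have e2 := Multiset.toFinset_card_le f.roots
      have e3 := card_roots' f
      rw [Finset.card_image_of_injOn hx] at e1
      omega
    obtain ⟨u, hu, v, hv, huv⟩ := Finset.one_lt_card.1 hcard
    simp only [Finset.mem_sdiff, Finset.mem_image, Multiset.mem_toFinset,
      mem_roots hfmonic.ne_zero, IsRoot.def] at hu hv
    obtain ⟨⟨i, hi, rfl⟩, hfi⟩ := hu
    obtain ⟨⟨j, hj, rfl⟩, hfj⟩ := hv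
    rcases lt_or_gt_of_ne huv with h | h
    · exact ⟨i, hi, j, hj, h, hfi, hfj⟩
    · exact ⟨j, hj, i, hi, h, hfj, hfi⟩
  set g : ι → ℝ := fun i => f.eval (x i) ^ 2
  have hg : ∀ i, 0 ≤ g i := fun i => sq_nonneg _
  have hgi : 0 < g i₀ := by positivity
  have hgj : 0 < g j₀ := by positivity
  have hsplit : ∀ (w : ι → ℝ) (t : ℝ), ∑ i ∈ s, w i * ((X - C t) * (f * f)).eval (x i) =
      ∑ i ∈ s, w i * x i * g i - t * ∑ i ∈ s, w i * g i := fun w t => by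
    rw [Finset.mul_sum, ← Finset.sum_sub_distrib]
    refine Finset.sum_congr rfl fun i _ => ?_
    simp only [eval_mul, eval_sub, eval_X, eval_C, g]
    ring
  rw [hsplit] at h₁ h₂
  have hD : 0 < ∑ i ∈ s, w₁ i * g i :=
    Finset.sum_pos' (fun i hi => mul_nonneg (hw₁ i hi).le (hg i))
      ⟨i₀, hi₀, mul_pos (hw₁ _ hi₀) hgi⟩
  have hB : 0 < ∑ i ∈ s, w₂ i * g i :=
    Finset.sum_pos' (fun i hi => mul_nonneg (hw₂ i hi).le (hg i))
      ⟨i₀, hi₀, mul_pos (hw₂ _ hi₀) hgi⟩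
  have hterm : ∀ i ∈ s, ∀ j ∈ s, 0 ≤ (w₁ i * w₂ j - w₁ j * w₂ i) * (x j - x i) := by
    intro i hi j hj
    rcases lt_trichotomy (x i) (x j) with h | h | h
    · exact mul_nonneg (sub_nonneg.2 (hratio i hi j hj h).le) (sub_nonneg.2 h.le)
    · simp [h]
    · exact mul_nonneg_of_nonpos_of_nonpos (sub_nonpos.2 (hratio j hj i hi h).le)
        (sub_nonpos.2 h.le)
  -- Chebyshev's argument: the ratio w₂/w₁ and x increase together, so the mean of x is larger for
  -- w₂ f² than for w₁ f². The pair (i₀, j₀) makes this strict.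
  have hdouble : 0 < ∑ i ∈ s, ∑ j ∈ s,
      (w₁ i * w₂ j - w₁ j * w₂ i) * (x j - x i) * (g i * g j) := by
    refine Finset.sum_pos' (fun i hi => Finset.sum_nonneg fun j hj =>
      mul_nonneg (hterm i hi j hj) (mul_nonneg (hg i) (hg j))) ⟨i₀, hi₀, ?_⟩
    refine Finset.sum_pos' (fun j hj =>
      mul_nonneg (hterm i₀ hi₀ j hj) (mul_nonneg (hg i₀) (hg j))) ⟨j₀, hj₀, ?_⟩
    exact mul_pos (mul_pos (sub_pos.2 (hratio _ hi₀ _ hj₀ hij)) (sub_pos.2 hij))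
      (mul_pos hgi hgj)
  have hexpand : ∑ i ∈ s, ∑ j ∈ s, (w₁ i * w₂ j - w₁ j * w₂ i) * (x j - x i) * (g i * g j) =
      2 * ((∑ i ∈ s, w₁ i * g i) * (∑ i ∈ s, w₂ i * x i * g i) -
        (∑ i ∈ s, w₁ i * x i * g i) * (∑ i ∈ s, w₂ i * g i)) := by
    have e : ∀ u v : ι → ℝ, (∑ i ∈ s, u i) * (∑ i ∈ s, v i) = ∑ i ∈ s, ∑ j ∈ s, u j * v i :=
      fun u v => by rw [Finset.sum_mul_sum, Finset.sum_comm]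
    rw [two_mul]
    nth_rw 1 [Finset.sum_mul_sum, Finset.sum_mul_sum]
    rw [e, e]
    simp only [← Finset.sum_add_distrib, ← Finset.sum_sub_distrib]
    exact Finset.sum_congr rfl fun i _ => Finset.sum_congr rfl fun j _ => by ring
  rw [hexpand] at hdouble
  by_contra hle
  rw [not_lt] at hle
  -- With m₁, m₂ these means, y₁ k ≤ m₁ < m₂ ≤ y₂ k, written without division.
  nlinarith [mul_le_mul_of_nonneg_right hle (mul_pos hD hB).le,
    mul_nonneg h₁ hB.le, mul_nonneg (neg_nonneg.2 h₂) hD.le]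

/-! ### The q-Racah difference operator -/

noncomputable section
theorem qPochhammer_succ (c q : ℝ) (k : ℕ) :
    qPochhammer c q (k + 1) = qPochhammer c q k * (1 - c * q ^ k) :=
  Finset.prod_range_succ _ _

theorem qPochhammer_succ' (c q : ℝ) (k : ℕ) :
    qPochhammer c q (k + 1) = (1 - c) * qPochhammer (c * q) q k := by
  unfold qPochhammer
  rw [Finset.prod_range_succ', pow_zero, mul_one, mul_comm]
  congr 1
  exact Finset.prod_congr rfl fun j _ => by ring

/-- The coefficient of `f (q z) - f z` in the `q`-Racah difference operator. -/
def racahUp (q G A b M z : ℝ) : ℝ :=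
  (1 - A * q * z) * (1 - b * G * M * z) * (1 - q * z / M) * (1 - G * z) /
    ((1 - G * z ^ 2) * (1 - G * q * z ^ 2))

/-- The coefficient of `f (z / q) - f z` in the `q`-Racah difference operator. -/
def racahDown (q G A b M z : ℝ) : ℝ :=
  (1 - z) * (1 - G * M * z / q) * (b - z / M) * (A * q - G * z) /
    ((1 - G * z ^ 2 / q) * (1 - G * z ^ 2))

/-- The functions `(1/z; q)_k (G z; q)_k`, on which the `q`-Racah operator is bidiagonal. -/
def racahBasis (q G : ℝ) (k : ℕ) (z : ℝ) : ℝ :=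
  qPochhammer (1 / z) q k * qPochhammer (G * z) q k

/-- The eigenvalues of the `q`-Racah operator. -/
def racahEigenvalue (q A b : ℝ) (k : ℕ) : ℝ :=
  (1 / q ^ k) * (1 - q ^ k) * (1 - A * b * q ^ (k + 1))

/-- The lower diagonal of the `q`-Racah operator. -/
def racahLower (q G A b M : ℝ) (k : ℕ) : ℝ :=
  -(1 / q ^ (k + 1)) * (1 - b * G * M * q ^ k) * (1 - A * q ^ (k + 1)) *
    (1 - q ^ (k + 1) / M) * (1 - q ^ (k + 1))

theorem racahBasis_succ (q G z : ℝ) (k : ℕ) :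
    racahBasis q G (k + 1) z =
      (1 - q ^ k / z) * (1 - G * z * q ^ k) * racahBasis q G k z := by
  unfold racahBasis
  rw [qPochhammer_succ, qPochhammer_succ]
  ring

/-- The shift z ↦ qz moves both products by one factor, so only end factors change. The multiplier 1
- Gz clears the denominator and is itself a factor of `racahUp`; in the downward shift 1 - 1/z plays
this role for `racahDown`. -/
theorem racahBasis_succ_up {q z : ℝ} (hq : q ≠ 0) (hz : z ≠ 0) (G : ℝ) (k : ℕ) :
    (1 - G * z) * racahBasis q G (k + 1) (q * z) =
      (1 - 1 / (q * z)) * (1 - G * z * q ^ k) * (1 - G * z * q ^ (k + 1)) *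
        racahBasis q G k z := by
  unfold racahBasis
  have h1 : 1 / (q * z) * q = 1 / z := by field_simp
  have h2 : (1 - G * z) * qPochhammer (G * (q * z)) q (k + 1) =
      qPochhammer (G * z) q k * (1 - G * z * q ^ k) * (1 - G * z * q ^ (k + 1)) := by
    rw [← qPochhammer_succ, ← qPochhammer_succ, qPochhammer_succ' _ _ (k + 1)]
    congr 2; ring
  rw [qPochhammer_succ' (1 / (q * z)), h1]
  linear_combination (1 - 1 / (q * z)) * qPochhammer (1 / z) q k * h2

theorem racahBasis_succ_down {q z : ℝ} (hq : q ≠ 0) (hz : z ≠ 0) (G : ℝ) (k : ℕ) :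
    (1 - 1 / z) * racahBasis q G (k + 1) (z / q) =
      (1 - G * z / q) * (1 - q ^ k / z) * (1 - q ^ (k + 1) / z) * racahBasis q G k z := by
  unfold racahBasis
  have h1 : G * (z / q) * q = G * z := by field_simp
  have h2 : (1 - 1 / z) * qPochhammer (1 / (z / q)) q (k + 1) =
      qPochhammer (1 / z) q k * (1 - q ^ k / z) * (1 - q ^ (k + 1) / z) := by
    have e : ∀ m, 1 - q ^ m / z = 1 - 1 / z * q ^ m := fun m => by ring
    rw [e, e, ← qPochhammer_succ, ← qPochhammer_succ, qPochhammer_succ' _ _ (k + 1)]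
    congr 2; field_simp
  rw [qPochhammer_succ' (G * (z / q)), h1]
  linear_combination (1 - G * z / q) * qPochhammer (G * z) q k * h2

/-- Each of φ_{k+1}(qz), φ_{k+1}(z), φ_{k+1}(z/q), with its coefficient, is a rational function of z
and q^k times φ_k(z), so a rational identity is left. -/
theorem racahOperator_basis_succ {q G M z : ℝ} (A b : ℝ) (hq : q ≠ 0) (hM : M ≠ 0) (hz : z ≠ 0)
    (h1 : 1 - G * z ^ 2 ≠ 0) (h2 : 1 - G * q * z ^ 2 ≠ 0) (h3 : 1 - G * z ^ 2 / q ≠ 0) (k : ℕ) :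
    racahUp q G A b M z * (racahBasis q G (k + 1) (q * z) - racahBasis q G (k + 1) z) +
      racahDown q G A b M z * (racahBasis q G (k + 1) (z / q) - racahBasis q G (k + 1) z) =
    racahEigenvalue q A b (k + 1) * racahBasis q G (k + 1) z +
      racahLower q G A b M k * racahBasis q G k z := by
  have hup : racahUp q G A b M z * racahBasis q G (k + 1) (q * z) =
      (1 - A * q * z) * (1 - b * G * M * z) * (1 - q * z / M) /
        ((1 - G * z ^ 2) * (1 - G * q * z ^ 2)) *
      ((1 - 1 / (q * z)) * (1 - G * z * q ^ k) * (1 - G * z * q ^ (k + 1)) *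
        racahBasis q G k z) := by
    rw [← racahBasis_succ_up hq hz, racahUp]; ring
  have hdown : racahDown q G A b M z * racahBasis q G (k + 1) (z / q) =
      -z * (1 - G * M * z / q) * (b - z / M) * (A * q - G * z) /
        ((1 - G * z ^ 2 / q) * (1 - G * z ^ 2)) *
      ((1 - G * z / q) * (1 - q ^ k / z) * (1 - q ^ (k + 1) / z) * racahBasis q G k z) := by
    rw [← racahBasis_succ_down hq hz, racahDown]; field_simp; ring
  rw [mul_sub, mul_sub, hup, hdown, racahBasis_succ, racahUp, racahDown, racahEigenvalue,
    racahLower]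
  have h3' : q - G * z ^ 2 ≠ 0 := by
    intro h; apply h3; rw [sub_eq_zero] at h; rw [← h]; field_simp; ring
  have hQ : q ^ k ≠ 0 := pow_ne_zero _ hq
  simp only [pow_succ, pow_zero, one_mul]
  generalize q ^ k = Q at *
  generalize racahBasis q G k z = F
  have h1' : 1 - z ^ 2 * G ≠ 0 := by rwa [mul_comm]
  have h2' : 1 - q * z ^ 2 * G ≠ 0 := by
    rwa [show q * z ^ 2 * G = G * q * z ^ 2 by ring]
  have h3'' : q - z ^ 2 * G ≠ 0 := by rwa [mul_comm _ G]
  field_simp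
  ring

/-- The first lattice point needs its own treatment: for G = q the denominator of `racahDown`
vanishes at z = 1. The downward term is absent there, owing to the factor 1 - z. -/
theorem racahOperator_basis_succ_one {q G M : ℝ} (A b : ℝ) (hq : q ≠ 0) (hM : M ≠ 0)
    (h1 : 1 - G ≠ 0) (h2 : 1 - G * q ≠ 0) (k : ℕ) :
    racahUp q G A b M 1 * (racahBasis q G (k + 1) q - racahBasis q G (k + 1) 1) =
    racahEigenvalue q A b (k + 1) * racahBasis q G (k + 1) 1 +
      racahLower q G A b M k * racahBasis q G k 1 := by
  have h0 : ∀ m, racahBasis q G (m + 1) 1 = 0 := fun m => by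
    rw [racahBasis, qPochhammer_succ']; simp
  have hup := racahBasis_succ_up hq one_ne_zero G k
  rw [mul_one, mul_one] at hup
  rw [h0, sub_zero, mul_zero, zero_add]
  have : racahBasis q G (k + 1) q = (1 - 1 / q) * (1 - G * q ^ k) * (1 - G * q ^ (k + 1)) *
        racahBasis q G k 1 / (1 - G) := by
    rw [eq_div_iff h1, mul_comm, hup]
  rw [this]
  -- Since φ_m(1) = 0 for m ≥ 1, only k = 0 has content.
  cases k with
  | succ m => rw [h0]; simp
  | zero =>
    have h2' : 1 - q * G ≠ 0 := by rwa [mul_comm]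
    rw [racahUp, racahLower]
    simp only [pow_zero, zero_add, pow_one, one_pow, mul_one]
    field_simp
    ring
  
/-- A difference operator of birth-and-death type is symmetric with respect to weights which
satisfy detailed balance. -/
theorem sum_operator_symm {m : ℕ} {w B D : ℕ → ℝ} (hD : D 0 = 0) (hB : B m = 0)
    (hw : ∀ i < m, w i * B i = w (i + 1) * D (i + 1)) (f g : ℕ → ℝ) :
    ∑ i ∈ Finset.range (m + 1),
        w i * ((B i * (f (i + 1) - f i) + D i * (f (i - 1) - f i)) * g i) =
      ∑ i ∈ Finset.range (m + 1),
        w i * (f i * (B i * (g (i + 1) - g i) + D i * (g (i - 1) - g i))) := by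
  rw [← sub_eq_zero, ← Finset.sum_sub_distrib, Finset.sum_range_succ]
  -- A discrete Wronskian: the difference of the two sums telescopes, `T 0` vanishes by `hD`, and
  -- the last summand, by `hB`, is -`T m`.
  set T : ℕ → ℝ := fun i => w i * D i * (f i * g (i - 1) - f (i - 1) * g i) with hT
  have hstep : ∀ i ∈ Finset.range m,
      w i * ((B i * (f (i + 1) - f i) + D i * (f (i - 1) - f i)) * g i) -
        w i * (f i * (B i * (g (i + 1) - g i) + D i * (g (i - 1) - g i))) = T (i + 1) - T i := by
    intro i hi
    simp only [hT, Nat.add_sub_cancel]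
    linear_combination (f (i + 1) * g i - f i * g (i + 1)) * hw i (Finset.mem_range.1 hi)
  rw [Finset.sum_congr rfl hstep, Finset.sum_range_sub]
  simp only [hT, hD, hB]
  ring

end

/-! ### Positive weights from detailed balance -/

noncomputable section

theorem qPochhammer_ne_zero {c q : ℝ} {k : ℕ} (h : ∀ j < k, c * q ^ j ≠ 1) :
    qPochhammer c q k ≠ 0 :=
  Finset.prod_ne_zero_iff.2 fun j hj => sub_ne_zero.2 (h j (Finset.mem_range.1 hj)).symm

theorem mul_pow_lt_one {c q : ℝ} (hq : 0 ≤ q) (hq1 : q ≤ 1) (hc : 0 ≤ c) (hc1 : c < 1) (j : ℕ) :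
    c * q ^ j < 1 :=
  (mul_le_of_le_one_right hc (pow_le_one₀ hq hq1)).trans_lt hc1

/-- The domain of the parameters `G = q^{2a}`, `A = q^β`, `b = q^α`. -/
structure RacahParams (q G A b : ℝ) : Prop where
  q_pos : 0 < q
  q_lt : q < 1
  G_pos : 0 < G
  G_lt : G < 1
  G_lt_A : G < A
  A_lt : A * q < 1
  b_pos : 0 < b
  b_lt : b * q < 1

/-- The `q`-Racah weights, normalized to be `1` at the first point. -/
def racahWeight (q G A b M : ℝ) (i : ℕ) : ℝ :=
  ∏ j ∈ Finset.range i, racahUp q G A b M (q ^ j) / racahDown q G A b M (q ^ (j + 1))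

/-- The coefficients of the `q`-Racah polynomial with respect to `racahBasis`. -/
def racahCoeff (q G A b M : ℝ) (n k : ℕ) : ℝ :=
  qPochhammer (1 / q ^ n) q k * qPochhammer (A * b * q ^ (n + 1)) q k
        / (qPochhammer (b * G * M) q k * qPochhammer (A * q) q k * qPochhammer (q / M) q k)
        * (q ^ k / qPochhammer q q k)

namespace RacahParams

variable {q G A b : ℝ}

theorem A_pos (P : RacahParams q G A b) : 0 < A := P.G_pos.trans P.G_lt_A

theorem pow_pos (P : RacahParams q G A b) (i : ℕ) : 0 < q ^ i := _root_.pow_pos P.q_pos i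

theorem pow_le (P : RacahParams q G A b) (i : ℕ) : q ^ i ≤ 1 := pow_le_one₀ P.q_pos.le P.q_lt.le

theorem up_const_pos (P : RacahParams q G A b) (i : ℕ) :
    0 < 1 - G * q * (q ^ i) ^ 2 := by
  rw [← pow_mul, sub_pos]
  exact mul_pow_lt_one P.q_pos.le P.q_lt.le (mul_pos P.G_pos P.q_pos).le
    (mul_lt_one_of_nonneg_of_lt_one_left P.G_pos.le P.G_lt P.q_lt.le) _

theorem sq_const_pos (P : RacahParams q G A b) (i : ℕ) : 0 < 1 - G * (q ^ i) ^ 2 := by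
  rw [← pow_mul, sub_pos]
  exact mul_pow_lt_one P.q_pos.le P.q_lt.le P.G_pos.le P.G_lt _

theorem down_const_pos (P : RacahParams q G A b) (i : ℕ) :
    0 < 1 - G * (q ^ (i + 1)) ^ 2 / q := by
  have := P.q_pos.ne'
  rw [show G * (q ^ (i + 1)) ^ 2 / q = G * q * (q ^ i) ^ 2 by rw [pow_succ q i]; field_simp]
  exact P.up_const_pos i

theorem A_factor_pos (P : RacahParams q G A b) (i : ℕ) : 0 < 1 - A * q * q ^ i :=
  sub_pos.2 (mul_pow_lt_one P.q_pos.le P.q_lt.le (mul_pos P.A_pos P.q_pos).le P.A_lt _)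

theorem G_factor_pos (P : RacahParams q G A b) (i : ℕ) : 0 < 1 - G * q ^ i :=
  sub_pos.2 (mul_pow_lt_one P.q_pos.le P.q_lt.le P.G_pos.le P.G_lt _)

theorem b_mul_pow_lt (P : RacahParams q G A b) (m : ℕ) : b * q ^ (m + 1) < q ^ m := by
  have := mul_lt_mul_of_pos_right P.b_lt (P.pow_pos m)
  rw [pow_succ]
  linarith

theorem b_factor_pos (P : RacahParams q G A b) {N : ℕ} (hN : 0 < N) (i : ℕ) :
    0 < 1 - b * G * q ^ N * q ^ i := by
  obtain ⟨m, rfl⟩ : ∃ m, N = m + 1 := ⟨N - 1, by omega⟩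
  have h1 : b * q ^ (m + 1) < 1 := (P.b_mul_pow_lt m).trans_le (P.pow_le m)
  have h2 : 0 < b * q ^ (m + 1) := mul_pos P.b_pos (P.pow_pos _)
  refine sub_pos.2 (mul_pow_lt_one P.q_pos.le P.q_lt.le ?_ ?_ _)
  · have := mul_pos h2 P.G_pos
    linarith
  · have := mul_lt_one_of_nonneg_of_lt_one_left h2.le h1 P.G_lt.le
    linarith

theorem M_factor_neg (P : RacahParams q G A b) {N i : ℕ} (hi : i + 1 < N) :
    1 - q * q ^ i / q ^ N < 0 := by
  rw [sub_neg, one_lt_div (P.pow_pos N), ← pow_succ']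
  exact pow_lt_pow_right_of_lt_one₀ P.q_pos P.q_lt hi

theorem b_down_factor_neg (P : RacahParams q G A b) {N i : ℕ} (hi : i + 1 < N) :
    b - q ^ (i + 1) / q ^ N < 0 := by
  rw [sub_neg, lt_div_iff₀ (P.pow_pos N)]
  have h : q ^ N ≤ q ^ (i + 2) := pow_le_pow_of_le_one P.q_pos.le P.q_lt.le hi
  exact (mul_le_mul_of_nonneg_left h P.b_pos.le).trans_lt (P.b_mul_pow_lt (i + 1))

theorem A_down_factor_pos (P : RacahParams q G A b) (i : ℕ) :
    0 < A * q - G * q ^ (i + 1) := by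
  rw [sub_pos, pow_succ, ← mul_assoc]
  exact mul_lt_mul_of_pos_right
    ((mul_le_of_le_one_right P.G_pos.le (P.pow_le i)).trans_lt P.G_lt_A) P.q_pos

theorem one_sub_pow_pos (P : RacahParams q G A b) (i : ℕ) : 0 < 1 - q ^ (i + 1) :=
  sub_pos.2 (pow_lt_one₀ P.q_pos.le P.q_lt (Nat.succ_ne_zero i))

theorem M_down_factor_pos (P : RacahParams q G A b) (N i : ℕ) :
    0 < 1 - G * q ^ N * q ^ (i + 1) / q := by
  have := P.q_pos.ne'
  rw [show G * q ^ N * q ^ (i + 1) / q = G * q ^ (N + i) by rw [pow_succ, pow_add]; field_simp]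
  exact P.G_factor_pos _

/-- Exactly one factor is negative, 1 - q z/M here and b - z/M in `down_neg`. Both coefficients
being negative, their quotients, and hence the weights, are positive. -/
theorem up_neg (P : RacahParams q G A b) {N i : ℕ} (hi : i + 1 < N) :
    racahUp q G A b (q ^ N) (q ^ i) < 0 := by
  refine div_neg_of_neg_of_pos ?_ (mul_pos (P.sq_const_pos i) (P.up_const_pos i))
  exact mul_neg_of_neg_of_pos (mul_neg_of_pos_of_neg
    (mul_pos (P.A_factor_pos i) (P.b_factor_pos (by omega) i)) (P.M_factor_neg hi))
    (P.G_factor_pos i)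

theorem down_neg (P : RacahParams q G A b) {N i : ℕ} (hi : i + 1 < N) :
    racahDown q G A b (q ^ N) (q ^ (i + 1)) < 0 := by
  refine div_neg_of_neg_of_pos ?_ (mul_pos (P.down_const_pos i) (P.sq_const_pos _))
  exact mul_neg_of_neg_of_pos (mul_neg_of_pos_of_neg
    (mul_pos (P.one_sub_pow_pos i) (P.M_down_factor_pos N i)) (P.b_down_factor_neg hi))
    (P.A_down_factor_pos i)

theorem weight_pos (P : RacahParams q G A b) {N i : ℕ} (hi : i < N) :
    0 < racahWeight q G A b (q ^ N) i :=
  Finset.prod_pos fun j hj => by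
    have := Finset.mem_range.1 hj
    exact div_pos_of_neg_of_neg (P.up_neg (by omega)) (P.down_neg (by omega))

theorem weight_balance (P : RacahParams q G A b) {N i : ℕ} (hi : i + 1 < N) :
    racahWeight q G A b (q ^ N) i * racahUp q G A b (q ^ N) (q ^ i) =
      racahWeight q G A b (q ^ N) (i + 1) * racahDown q G A b (q ^ N) (q ^ (i + 1)) := by
  have := (P.down_neg hi).ne
  rw [racahWeight, racahWeight, Finset.prod_range_succ]
  field_simp

end RacahParams

/-! ### Dependence of the weights on the parameters -/

/-- The hypothesis compares the quotients w(i+1)/w(i) of neighbouring weights; multiplying them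
along the lattice compares any two points. -/
theorem weight_cross_lt {q G A₁ b₁ A₂ b₂ : ℝ} (P₁ : RacahParams q G A₁ b₁)
    (P₂ : RacahParams q G A₂ b₂) {N : ℕ}
    (h : ∀ i, i + 1 < N →
      racahUp q G A₁ b₁ (q ^ N) (q ^ i) * racahDown q G A₂ b₂ (q ^ N) (q ^ (i + 1)) <
        racahUp q G A₂ b₂ (q ^ N) (q ^ i) * racahDown q G A₁ b₁ (q ^ N) (q ^ (i + 1)))
    {i j : ℕ} (hij : i < j) (hj : j < N) :
    racahWeight q G A₁ b₁ (q ^ N) j * racahWeight q G A₂ b₂ (q ^ N) i <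
      racahWeight q G A₁ b₁ (q ^ N) i * racahWeight q G A₂ b₂ (q ^ N) j := by
  -- A single step turns ≤ into <, so the induction can start from the trivial equality at j = i.
  have hstep : ∀ j, j + 1 < N → i ≤ j →
      racahWeight q G A₁ b₁ (q ^ N) j * racahWeight q G A₂ b₂ (q ^ N) i ≤
        racahWeight q G A₁ b₁ (q ^ N) i * racahWeight q G A₂ b₂ (q ^ N) j →
      racahWeight q G A₁ b₁ (q ^ N) (j + 1) * racahWeight q G A₂ b₂ (q ^ N) i <
        racahWeight q G A₁ b₁ (q ^ N) i * racahWeight q G A₂ b₂ (q ^ N) (j + 1) := by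
    intro j hj hij hle
    have hr : racahUp q G A₁ b₁ (q ^ N) (q ^ j) / racahDown q G A₁ b₁ (q ^ N) (q ^ (j + 1)) <
        racahUp q G A₂ b₂ (q ^ N) (q ^ j) / racahDown q G A₂ b₂ (q ^ N) (q ^ (j + 1)) := by
      rw [← neg_div_neg_eq, ← neg_div_neg_eq (racahUp q G A₂ b₂ _ _),
        div_lt_div_iff₀ (neg_pos.2 (P₁.down_neg hj)) (neg_pos.2 (P₂.down_neg hj)), neg_mul_neg,
        neg_mul_neg]
      exact h j hj
    have hr0 := div_pos_of_neg_of_neg (P₁.up_neg hj) (P₁.down_neg hj)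
    have e : ∀ A b, racahWeight q G A b (q ^ N) (j + 1) = racahWeight q G A b (q ^ N) j *
        (racahUp q G A b (q ^ N) (q ^ j) / racahDown q G A b (q ^ N) (q ^ (j + 1))) :=
      fun A b => Finset.prod_range_succ _ _
    have h1 := mul_le_mul_of_nonneg_right hle hr0.le
    have h2 := mul_lt_mul_of_pos_left hr
      (mul_pos (P₁.weight_pos (show i < N by omega)) (P₂.weight_pos (show j < N by omega)))
    rw [e, e]
    linarith
  induction j, hij using Nat.le_induction with
  | base => exact hstep i hj le_rfl le_rfl
  | succ j hij ih => exact hstep j hj (by omega) (ih (by omega)).le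

/-- Only 1 - Aqz and Aq - Gqz involve A, where z = q^i. Their cross difference is (A₁ - A₂) q (1 -
Gqz²) up to sign, and the remaining factors `u`, `d` are both negative. -/
theorem cross_lt_of_A_lt {q G A₁ A₂ b : ℝ} (P₁ : RacahParams q G A₁ b)
    (hA : A₂ < A₁) {N i : ℕ} (hi : i + 1 < N) :
    racahUp q G A₁ b (q ^ N) (q ^ i) * racahDown q G A₂ b (q ^ N) (q ^ (i + 1)) <
      racahUp q G A₂ b (q ^ N) (q ^ i) * racahDown q G A₁ b (q ^ N) (q ^ (i + 1)) := by
  set u := (1 - b * G * q ^ N * q ^ i) * (1 - q * q ^ i / q ^ N) * (1 - G * q ^ i) /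
    ((1 - G * (q ^ i) ^ 2) * (1 - G * q * (q ^ i) ^ 2)) with hu
  set d := (1 - q ^ (i + 1)) * (1 - G * q ^ N * q ^ (i + 1) / q) * (b - q ^ (i + 1) / q ^ N) /
    ((1 - G * (q ^ (i + 1)) ^ 2 / q) * (1 - G * (q ^ (i + 1)) ^ 2)) with hd
  have hu0 : u < 0 := div_neg_of_neg_of_pos (mul_neg_of_neg_of_pos (mul_neg_of_pos_of_neg
    (P₁.b_factor_pos (by omega) i) (P₁.M_factor_neg hi)) (P₁.G_factor_pos i))
    (mul_pos (P₁.sq_const_pos i) (P₁.up_const_pos i))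
  have hd0 : d < 0 := div_neg_of_neg_of_pos (mul_neg_of_pos_of_neg
    (mul_pos (P₁.one_sub_pow_pos i) (P₁.M_down_factor_pos N i)) (P₁.b_down_factor_neg hi))
    (mul_pos (P₁.down_const_pos i) (P₁.sq_const_pos _))
  have eU : ∀ A, racahUp q G A b (q ^ N) (q ^ i) = u * (1 - A * q * q ^ i) := fun A => by
    rw [racahUp, hu]; ring
  have eD : ∀ A, racahDown q G A b (q ^ N) (q ^ (i + 1)) = d * (A * q - G * q ^ (i + 1)) :=
    fun A => by rw [racahDown, hd]; ring
  rw [eU, eU, eD, eD]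
  have := mul_pos (mul_pos (mul_pos_of_neg_of_neg hu0 hd0) (sub_pos.2 hA))
    (mul_pos P₁.q_pos (P₁.up_const_pos i))
  rw [pow_succ]
  linarith

/-- Here the cross difference of 1 - bGMz and b - qz/M is (b₂ - b₁)(1 - Gqz²), while `u` and `d`
have opposite signs. -/
theorem cross_lt_of_b_lt {q G A b₁ b₂ : ℝ} (P₁ : RacahParams q G A b₁)
    (hb : b₁ < b₂) {N i : ℕ} (hi : i + 1 < N) :
    racahUp q G A b₁ (q ^ N) (q ^ i) * racahDown q G A b₂ (q ^ N) (q ^ (i + 1)) <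
      racahUp q G A b₂ (q ^ N) (q ^ i) * racahDown q G A b₁ (q ^ N) (q ^ (i + 1)) := by
  set u := (1 - A * q * q ^ i) * (1 - q * q ^ i / q ^ N) * (1 - G * q ^ i) /
    ((1 - G * (q ^ i) ^ 2) * (1 - G * q * (q ^ i) ^ 2)) with hu
  set d := (1 - q ^ (i + 1)) * (1 - G * q ^ N * q ^ (i + 1) / q) * (A * q - G * q ^ (i + 1)) /
    ((1 - G * (q ^ (i + 1)) ^ 2 / q) * (1 - G * (q ^ (i + 1)) ^ 2)) with hd
  have hu0 : u < 0 := div_neg_of_neg_of_pos (mul_neg_of_neg_of_pos (mul_neg_of_pos_of_neg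
    (P₁.A_factor_pos i) (P₁.M_factor_neg hi)) (P₁.G_factor_pos i))
    (mul_pos (P₁.sq_const_pos i) (P₁.up_const_pos i))
  have hd0 : 0 < d := div_pos
    (mul_pos (mul_pos (P₁.one_sub_pow_pos i) (P₁.M_down_factor_pos N i)) (P₁.A_down_factor_pos i))
    (mul_pos (P₁.down_const_pos i) (P₁.sq_const_pos _))
  have eU : ∀ b, racahUp q G A b (q ^ N) (q ^ i) = u * (1 - b * G * q ^ N * q ^ i) := fun b => by
    rw [racahUp, hu]; ring
  have eD : ∀ b, racahDown q G A b (q ^ N) (q ^ (i + 1)) = d * (b - q ^ (i + 1) / q ^ N) :=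
    fun b => by rw [racahDown, hd]; ring
  rw [eU, eU, eD, eD]
  have h1 : 0 < (b₂ - b₁) * (1 - G * q * (q ^ i) ^ 2) :=
    mul_pos (sub_pos.2 hb) (P₁.up_const_pos i)
  have h2 : (1 - b₁ * G * q ^ N * q ^ i) * (b₂ - q ^ (i + 1) / q ^ N) -
      (1 - b₂ * G * q ^ N * q ^ i) * (b₁ - q ^ (i + 1) / q ^ N) =
      (b₂ - b₁) * (1 - G * q * (q ^ i) ^ 2) := by
    have := (P₁.pow_pos N).ne'
    rw [pow_succ]
    field_simp
    ring
  have := mul_neg_of_neg_of_pos (mul_neg_of_neg_of_pos hu0 hd0) (h2 ▸ h1)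
  linarith

/-! ### Eigenvectors and orthogonality on the lattice -/

/-- The `q`-Racah operator on functions on the lattice `0, 1, 2, …`. -/
def racahOperator (q G A b M : ℝ) (f : ℕ → ℝ) (i : ℕ) : ℝ :=
  racahUp q G A b M (q ^ i) * (f (i + 1) - f i) + racahDown q G A b M (q ^ i) * (f (i - 1) - f i)

namespace RacahParams

variable {q G A b : ℝ}

theorem operator_basis_succ (P : RacahParams q G A b) (N k i : ℕ) :
    racahOperator q G A b (q ^ N) (fun i => racahBasis q G (k + 1) (q ^ i)) i =
      racahEigenvalue q A b (k + 1) * racahBasis q G (k + 1) (q ^ i) +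
        racahLower q G A b (q ^ N) k * racahBasis q G k (q ^ i) := by
  have hq := P.q_pos.ne'
  have hM := (P.pow_pos N).ne'
  cases i with
  | zero =>
    have h1 := P.G_factor_pos 0
    have h2 := P.up_const_pos 0
    simp only [pow_zero, one_pow, mul_one] at h1 h2
    have := racahOperator_basis_succ_one A b hq hM h1.ne' h2.ne' k
    simpa [racahOperator, racahDown] using this
  | succ i =>
    have := racahOperator_basis_succ A b hq hM (P.pow_pos (i + 1)).ne' (P.sq_const_pos _).ne'
      (P.up_const_pos _).ne' (P.down_const_pos _).ne' k
    rw [← this, racahOperator, pow_succ' q (i + 1), Nat.add_sub_cancel, pow_succ q i,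
      mul_div_cancel_right₀ _ hq]

/-- The boundary terms vanish through the factor 1 - z at z = 1 and, because M = q^N, through 1 -
qz/M at the last point z = q^{N-1}. -/
theorem operator_symm (P : RacahParams q G A b) {N : ℕ} (hN : 0 < N) (f g : ℕ → ℝ) :
    ∑ i ∈ Finset.range N, racahWeight q G A b (q ^ N) i *
        (racahOperator q G A b (q ^ N) f i * g i) =
      ∑ i ∈ Finset.range N, racahWeight q G A b (q ^ N) i *
        (f i * racahOperator q G A b (q ^ N) g i) := by
  obtain ⟨m, rfl⟩ := Nat.exists_eq_succ_of_ne_zero hN.ne'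
  refine sum_operator_symm (B := fun i => racahUp q G A b (q ^ (m + 1)) (q ^ i))
    (D := fun i => racahDown q G A b (q ^ (m + 1)) (q ^ i)) ?_ ?_ ?_ f g
  · simp [racahDown]
  · have : q * q ^ m / q ^ (m + 1) = 1 := by
      rw [← pow_succ', div_self (P.pow_pos _).ne']
    simp [racahUp, this]
  · exact fun i hi => P.weight_balance (by simpa using hi)

theorem A_mul_b_lt (P : RacahParams q G A b) (m : ℕ) : A * b * q ^ (m + 2) < 1 := by
  have h1 : A * b * q ^ 2 < 1 := by
    have := mul_lt_one_of_nonneg_of_lt_one_left (mul_pos P.A_pos P.q_pos).le P.A_lt P.b_lt.le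
    linarith
  have := mul_pow_lt_one P.q_pos.le P.q_lt.le
    (mul_pos (mul_pos P.A_pos P.b_pos) (P.pow_pos 2)).le h1 m
  rw [pow_add]
  linarith

theorem eigenvalue_sub (P : RacahParams q G A b) (n k : ℕ) :
    racahEigenvalue q A b n - racahEigenvalue q A b k =
      (1 / q ^ n - 1 / q ^ k) * (1 - A * b * q ^ (n + k + 1)) := by
  have h1 := (P.pow_pos n).ne'
  have h2 := (P.pow_pos k).ne'
  rw [racahEigenvalue, racahEigenvalue, pow_succ, pow_succ, pow_succ, pow_add]
  field_simp
  ring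

theorem eigenvalue_ne (P : RacahParams q G A b) {n k : ℕ} (hk : k < n) :
    racahEigenvalue q A b n - racahEigenvalue q A b k ≠ 0 := by
  rw [P.eigenvalue_sub]
  -- k < n forces n + k + 1 ≥ 2, and A b q² < 1 follows from A q < 1 and b q < 1.
  obtain ⟨m, hm⟩ : ∃ m, n + k + 1 = m + 2 := ⟨n + k - 1, by omega⟩
  rw [hm]
  refine mul_ne_zero ?_ (sub_pos.2 (P.A_mul_b_lt m)).ne'
  have := one_div_lt_one_div_of_lt (P.pow_pos n) (pow_lt_pow_right_of_lt_one₀ P.q_pos P.q_lt hk)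
  exact (sub_pos.2 this).ne'

theorem M_ne (P : RacahParams q G A b) {N j : ℕ} (hj : j + 1 < N) : q / q ^ N * q ^ j ≠ 1 := by
  have := P.M_factor_neg hj
  intro h
  rw [div_mul_eq_mul_div] at h
  linarith

/-- This is the term ratio of the ₄φ₃ series, in the form of the recurrence for the coordinates of
an eigenvector of a bidiagonal operator. -/
theorem coeff_succ (P : RacahParams q G A b) {n N k : ℕ} (hnN : n < N) (hk : k < n) :
    racahCoeff q G A b (q ^ N) n (k + 1) * racahLower q G A b (q ^ N) k =
      (racahEigenvalue q A b n - racahEigenvalue q A b k) * racahCoeff q G A b (q ^ N) n k := by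
  have h1 := (P.b_factor_pos (show 0 < N by omega) k).ne'
  have h2 := (P.A_factor_pos k).ne'
  have h3 : 1 - q / q ^ N * q ^ k ≠ 0 := sub_ne_zero.2 (P.M_ne (by omega)).symm
  have h4 : 1 - q * q ^ k ≠ 0 := by rw [← pow_succ']; exact (P.one_sub_pow_pos k).ne'
  have h5 := (P.pow_pos k).ne'
  have h6 := (P.pow_pos n).ne'
  have h7 := P.q_pos.ne'
  have e : racahCoeff q G A b (q ^ N) n (k + 1) = racahCoeff q G A b (q ^ N) n k *
      ((1 - 1 / q ^ n * q ^ k) * (1 - A * b * q ^ (n + 1) * q ^ k) /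
        ((1 - b * G * q ^ N * q ^ k) * (1 - A * q * q ^ k) * (1 - q / q ^ N * q ^ k)) *
        (q / (1 - q * q ^ k))) := by
    simp only [racahCoeff, qPochhammer_succ, pow_succ q k]
    simp only [div_eq_mul_inv, mul_inv]
    ring
  have e2 : racahLower q G A b (q ^ N) k = -(1 / (q ^ k * q)) * ((1 - b * G * q ^ N * q ^ k) *
      (1 - A * q * q ^ k) * (1 - q / q ^ N * q ^ k)) * (1 - q * q ^ k) := by
    rw [racahLower, pow_succ]; ring
  rw [e, e2, P.eigenvalue_sub]
  have h8 := mul_ne_zero (mul_ne_zero h1 h2) h3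
  have e3 : A * b * q ^ (n + k + 1) = A * b * q ^ (n + 1) * q ^ k := by ring
  rw [e3]
  generalize (1 - b * G * q ^ N * q ^ k) * (1 - A * q * q ^ k) * (1 - q / q ^ N * q ^ k) = Z at *
  generalize 1 - q * q ^ k = Z' at *
  field_simp
  ring

theorem coeff_self_ne_zero (P : RacahParams q G A b) {n N : ℕ} (hnN : n < N) :
    racahCoeff q G A b (q ^ N) n n ≠ 0 := by
  refine mul_ne_zero (div_ne_zero (mul_ne_zero ?_ ?_) (mul_ne_zero (mul_ne_zero ?_ ?_) ?_))
    (div_ne_zero (P.pow_pos n).ne' ?_)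
  · refine qPochhammer_ne_zero fun j hj h => ?_
    have := pow_lt_pow_right_of_lt_one₀ P.q_pos P.q_lt hj
    rw [one_div_mul_eq_div, div_eq_one_iff_eq (P.pow_pos n).ne'] at h
    exact this.ne' h
  · refine qPochhammer_ne_zero fun j _ => ?_
    obtain ⟨m, hm⟩ : ∃ m, n + 1 + j = m + 2 := ⟨n + j - 1, by omega⟩
    rw [mul_assoc (A * b), ← pow_add, hm]
    exact (P.A_mul_b_lt m).ne
  · exact qPochhammer_ne_zero fun j _ => (sub_pos.1 (P.b_factor_pos (by omega) j)).ne
  · exact qPochhammer_ne_zero fun j _ => (sub_pos.1 (P.A_factor_pos j)).ne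
  · exact qPochhammer_ne_zero fun j hj => P.M_ne (by omega)
  · refine qPochhammer_ne_zero fun j _ => ?_
    rw [← pow_succ']
    exact (sub_pos.1 (P.one_sub_pow_pos j)).ne

theorem operator_eigen (P : RacahParams q G A b) {n N : ℕ} (hnN : n < N) (i : ℕ) :
    racahOperator q G A b (q ^ N) (fun i => ∑ k ∈ Finset.range (n + 1),
        racahCoeff q G A b (q ^ N) n k * racahBasis q G k (q ^ i)) i =
      racahEigenvalue q A b n * ∑ k ∈ Finset.range (n + 1),
        racahCoeff q G A b (q ^ N) n k * racahBasis q G k (q ^ i) := by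
  have hlin : racahOperator q G A b (q ^ N) (fun i => ∑ k ∈ Finset.range (n + 1),
        racahCoeff q G A b (q ^ N) n k * racahBasis q G k (q ^ i)) i =
      ∑ k ∈ Finset.range (n + 1), racahCoeff q G A b (q ^ N) n k *
        racahOperator q G A b (q ^ N) (fun i => racahBasis q G k (q ^ i)) i := by
    simp only [racahOperator, ← Finset.sum_sub_distrib, Finset.mul_sum, ← Finset.sum_add_distrib]
    exact Finset.sum_congr rfl fun k _ => by ring
  have h0 : racahOperator q G A b (q ^ N) (fun i => racahBasis q G 0 (q ^ i)) i = 0 := by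
    simp [racahOperator, racahBasis, qPochhammer]
  rw [hlin, Finset.sum_range_succ', h0, mul_zero, add_zero]
  simp only [P.operator_basis_succ, mul_add, Finset.sum_add_distrib]
  have h1 : ∑ k ∈ Finset.range n, racahCoeff q G A b (q ^ N) n (k + 1) *
        (racahLower q G A b (q ^ N) k * racahBasis q G k (q ^ i)) =
      ∑ k ∈ Finset.range n, (racahEigenvalue q A b n - racahEigenvalue q A b k) *
        (racahCoeff q G A b (q ^ N) n k * racahBasis q G k (q ^ i)) := by
    refine Finset.sum_congr rfl fun k hk => ?_
    linear_combination racahBasis q G k (q ^ i) * P.coeff_succ hnN (Finset.mem_range.1 hk)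
  have h2 : ∑ k ∈ Finset.range n, racahCoeff q G A b (q ^ N) n (k + 1) *
        (racahEigenvalue q A b (k + 1) * racahBasis q G (k + 1) (q ^ i)) =
      ∑ k ∈ Finset.range (n + 1), racahCoeff q G A b (q ^ N) n k *
        (racahEigenvalue q A b k * racahBasis q G k (q ^ i)) := by
    rw [Finset.sum_range_succ' _ n]
    simp [racahEigenvalue]
  rw [h1, h2, Finset.sum_range_succ, Finset.sum_range_succ, mul_add, Finset.mul_sum,
    add_right_comm, ← Finset.sum_add_distrib]
  congr 1
  · exact Finset.sum_congr rfl fun k _ => by ring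
  · ring

/-- Symmetry and the bidiagonal form express (λ_n - λ_m)⟨R_n, φ_m⟩ as a multiple of ⟨R_n, φ_{m-1}⟩,
zero by induction; for m = 0 that term is absent. -/
theorem orthogonal_basis (P : RacahParams q G A b) {n N : ℕ} (hnN : n < N) (m : ℕ) (hm : m < n) :
    ∑ i ∈ Finset.range N, racahWeight q G A b (q ^ N) i *
      ((∑ k ∈ Finset.range (n + 1), racahCoeff q G A b (q ^ N) n k * racahBasis q G k (q ^ i)) *
        racahBasis q G m (q ^ i)) = 0 := by
  have hsymm := P.operator_symm (show 0 < N by omega) (fun i => ∑ k ∈ Finset.range (n + 1),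
    racahCoeff q G A b (q ^ N) n k * racahBasis q G k (q ^ i))
    (fun i => racahBasis q G m (q ^ i))
  simp only [P.operator_eigen hnN] at hsymm
  have hl : ∀ (c : ℝ) (w u v : ℕ → ℝ), ∑ i ∈ Finset.range N, w i * (c * u i * v i) =
      c * ∑ i ∈ Finset.range N, w i * (u i * v i) := fun c w u v => by
    rw [Finset.mul_sum]; exact Finset.sum_congr rfl fun i _ => by ring
  rw [hl] at hsymm
  refine (mul_eq_zero.1 (?_ : (racahEigenvalue q A b n - racahEigenvalue q A b m) * _ = 0)
    ).resolve_left (P.eigenvalue_ne hm)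
  rw [sub_mul, hsymm, sub_eq_zero, ← hl]
  cases m with
  | zero =>
    refine Finset.sum_congr rfl fun i _ => ?_
    simp [racahOperator, racahBasis, qPochhammer, racahEigenvalue]
  | succ m =>
    have ih := P.orthogonal_basis hnN m (by omega)
    simp only [P.operator_basis_succ]
    rw [← add_zero (∑ i ∈ Finset.range N, _ * (racahEigenvalue q A b (m + 1) * _ * _)),
      ← mul_zero (racahLower q G A b (q ^ N) m), ← ih, Finset.mul_sum, ← Finset.sum_add_distrib]
    exact Finset.sum_congr rfl fun i _ => by ring

end RacahParams
end

/-! ### From the lattice to polynomials in x(s) -/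

noncomputable section

theorem qQuadraticGrid_lt {q s t : ℝ} (hq : 0 < q) (hq1 : q < 1) (hs : 0 < s) (hst : s < t) :
    qQuadraticGrid q s < qQuadraticGrid q t := by
  have h1 : q ^ t < q ^ s := Real.rpow_lt_rpow_of_exponent_gt hq hq1 hst
  have h2 : q ^ s < 1 := Real.rpow_lt_one hq.le hq1 hs
  have h3 : 0 < q ^ t := Real.rpow_pos_of_pos hq t
  have h4 : 0 < q ^ s := h3.trans h1
  have h5 : q ^ s * q ^ t < 1 := mul_lt_one_of_nonneg_of_lt_one_left h4.le h2 (h1.trans h2).le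
  unfold qQuadraticGrid
  rw [Real.rpow_neg hq.le, Real.rpow_neg hq.le]
  have : (q ^ t)⁻¹ - (q ^ s)⁻¹ - (q ^ s - q ^ t) =
      (q ^ s - q ^ t) * (1 - q ^ s * q ^ t) / (q ^ s * q ^ t) := by
    field_simp
  have h6 : 0 < (q ^ s - q ^ t) * (1 - q ^ s * q ^ t) / (q ^ s * q ^ t) :=
    div_pos (mul_pos (sub_pos.2 h1) (sub_pos.2 h5)) (mul_pos h4 h3)
  linarith

theorem strictMono_qQuadraticGrid {q a : ℝ} (hq : 0 < q) (hq1 : q < 1) (ha : 0 < a) :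
    StrictMono fun i : ℕ => qQuadraticGrid q (a + i) := fun i j hij =>
  qQuadraticGrid_lt hq hq1 (by positivity) (by simpa using hij)

open Polynomial in
/-- The polynomial in `x(s)` with value `(q^{a-s}; q)_k (q^{s+a}; q)_k`. -/
def racahBasisPoly (q a : ℝ) (k : ℕ) : ℝ[X] :=
  ∏ j ∈ Finset.range k, (1 - C (2 * q ^ (a + j)) * X + C (q ^ (2 * (a + j))))

open Polynomial in
theorem racahBasisPoly_eval {q : ℝ} (hq : 0 < q) (a : ℝ) (k i : ℕ) :
    (racahBasisPoly q a k).eval (qQuadraticGrid q (a + i)) =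
      racahBasis q (q ^ (2 * a)) k (q ^ i) := by
  simp only [racahBasisPoly, eval_prod, eval_add, eval_sub, eval_one, eval_mul, eval_C, eval_X]
  rw [← qPochhammer_grid hq, racahBasis]
  congr 2
  · rw [show a - (a + i) = -(i : ℝ) by ring, Real.rpow_neg hq.le, Real.rpow_natCast, one_div]
  · rw [show a + i + a = 2 * a + (i : ℝ) by ring, Real.rpow_add hq, Real.rpow_natCast]

open Polynomial in
theorem racahBasisPoly_natDegree {q : ℝ} (hq : 0 < q) (a : ℝ) (k : ℕ) :
    (racahBasisPoly q a k).natDegree = k := by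
  have h : ∀ j : ℕ, (1 - C (2 * q ^ (a + j)) * X + C (q ^ (2 * (a + j))) : ℝ[X]).natDegree = 1 := by
    intro j
    have : q ^ (a + j) ≠ 0 := (Real.rpow_pos_of_pos hq _).ne'
    compute_degree!
  rw [racahBasisPoly, natDegree_prod _ _ fun j _ h0 => by have := h j; simp only [h0, natDegree_zero, zero_ne_one] at this]
  simp only [h, Finset.sum_const, Finset.card_range, smul_eq_mul, mul_one]

theorem racahBasisPoly_ne_zero {q : ℝ} (hq : 0 < q) (a : ℝ) (k : ℕ) :
    racahBasisPoly q a k ≠ 0 := by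
  cases k with
  | zero => simp [racahBasisPoly]
  | succ k =>
    refine Polynomial.ne_zero_of_natDegree_gt (n := 0) ?_
    rw [racahBasisPoly_natDegree hq]
    exact k.succ_pos

open Polynomial in
/-- A linear functional which vanishes on polynomials of the degrees `0, …, n - 1` vanishes on
all polynomials of degree less than `n`. -/
theorem eq_zero_of_degree_lt {K : Type*} [Field K] (l : K[X] →ₗ[K] K) {φ : ℕ → K[X]}
    (hφ : ∀ k, (φ k).natDegree = k) (hφ0 : ∀ k, φ k ≠ 0) {n : ℕ} (hl : ∀ k < n, l (φ k) = 0)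
    (h : K[X]) (hh : h.degree < n) : l h = 0 := by
  induction n generalizing h with
  | zero =>
    have : h = 0 := by simpa using hh
    rw [this, map_zero]
  | succ n ih =>
    -- This multiple of `φ n` cancels the coefficient of `h` in degree n.
    set c := h.coeff n / (φ n).coeff n with hc
    have hlc : (φ n).coeff n ≠ 0 := by
      have := leadingCoeff_ne_zero.2 (hφ0 n)
      rwa [leadingCoeff, hφ] at this
    have hlt : (h - c • φ n).degree < n := by
      rw [degree_lt_iff_coeff_zero] at hh ⊢
      intro m hm
      rw [coeff_sub, coeff_smul, smul_eq_mul]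
      rcases hm.eq_or_lt with rfl | hlt
      · rw [hc, div_mul_cancel₀ _ hlc, sub_self]
      · rw [hh m hlt, coeff_eq_zero_of_natDegree_lt (by rwa [hφ]), mul_zero, sub_zero]
    have := ih (fun k hk => hl k (hk.trans n.lt_succ_self)) _ hlt
    rw [map_sub, map_smul, hl n n.lt_succ_self, smul_zero, sub_zero] at this
    exact this

theorem racahParams_of_exponents {q a α β : ℝ} (hq : 0 < q) (hq1 : q < 1) (ha : 0 < a)
    (hα : -1 < α) (hβ : -1 < β) (hβa : β < 2 * a) :
    RacahParams q (q ^ (2 * a)) (q ^ β) (q ^ α) where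
  q_pos := hq
  q_lt := hq1
  G_pos := Real.rpow_pos_of_pos hq _
  G_lt := Real.rpow_lt_one hq.le hq1 (by positivity)
  G_lt_A := Real.rpow_lt_rpow_of_exponent_gt hq hq1 hβa
  A_lt := by
    rw [← Real.rpow_add_one hq.ne']
    exact Real.rpow_lt_one hq.le hq1 (by linarith)
  b_pos := Real.rpow_pos_of_pos hq _
  b_lt := by
    rw [← Real.rpow_add_one hq.ne']
    exact Real.rpow_lt_one hq.le hq1 (by linarith)

open Polynomial in
theorem qRacah_eq_sum {q : ℝ} (hq : 0 < q) (n N : ℕ) (a α β : ℝ) :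
    qRacah n N a α β q = ∑ k ∈ Finset.range (n + 1),
      C (racahCoeff q (q ^ (2 * a)) (q ^ β) (q ^ α) (q ^ N) n k) * racahBasisPoly q a k := by
  have h1 : q ^ (-(n : ℝ)) = 1 / q ^ n := by
    rw [Real.rpow_neg hq.le, Real.rpow_natCast, one_div]
  have h2 : q ^ (α + β + n + 1) = q ^ β * q ^ α * q ^ (n + 1) := by
    rw [← Real.rpow_natCast, ← Real.rpow_add hq, ← Real.rpow_add hq]
    push_cast
    ring_nf
  have h3 : q ^ (2 * a + α + N) = q ^ α * q ^ (2 * a) * q ^ N := by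
    rw [Real.rpow_add hq, Real.rpow_add hq, Real.rpow_natCast, mul_comm (q ^ α)]
  have h4 : q ^ (1 - (N : ℝ)) = q / q ^ N := by
    rw [Real.rpow_sub hq, Real.rpow_one, Real.rpow_natCast]
  simp only [qRacah, racahCoeff, racahBasisPoly, h1, h2, h3, h4, Real.rpow_add_one hq.ne' β]

open Polynomial in
theorem qRacah_eval_lattice {q : ℝ} (hq : 0 < q) (n N : ℕ) (a α β : ℝ) (i : ℕ) :
    (qRacah n N a α β q).eval (qQuadraticGrid q (a + i)) = ∑ k ∈ Finset.range (n + 1),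
      racahCoeff q (q ^ (2 * a)) (q ^ β) (q ^ α) (q ^ N) n k *
        racahBasis q (q ^ (2 * a)) k (q ^ i) := by
  rw [qRacah_eq_sum hq, eval_finsetSum]
  simp only [eval_mul, eval_C, racahBasisPoly_eval hq]

open Polynomial in
theorem qRacah_natDegree {q a α β : ℝ} (P : RacahParams q (q ^ (2 * a)) (q ^ β) (q ^ α))
    {n N : ℕ} (hnN : n < N) :
    (qRacah n N a α β q).natDegree = n ∧ qRacah n N a α β q ≠ 0 := by
  have hcoeff : (qRacah n N a α β q).coeff n ≠ 0 := by
    rw [qRacah_eq_sum P.q_pos, finsetSum_coeff, Finset.sum_range_succ, Finset.sum_eq_zero,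
      zero_add, coeff_C_mul]
    · refine mul_ne_zero (P.coeff_self_ne_zero hnN) ?_
      have := leadingCoeff_ne_zero.2 (racahBasisPoly_ne_zero P.q_pos a n)
      rwa [leadingCoeff, racahBasisPoly_natDegree P.q_pos] at this
    · intro k hk
      rw [coeff_C_mul, coeff_eq_zero_of_natDegree_lt, mul_zero]
      rw [racahBasisPoly_natDegree P.q_pos]
      exact Finset.mem_range.1 hk
  refine ⟨le_antisymm ?_ (le_natDegree_of_ne_zero hcoeff), fun h => hcoeff (by rw [h, coeff_zero])⟩
  rw [qRacah_eq_sum P.q_pos]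
  refine natDegree_sum_le_of_forall_le _ _ fun k hk => ?_
  refine (natDegree_C_mul_le _ _).trans ?_
  rw [racahBasisPoly_natDegree P.q_pos]
  exact Nat.lt_succ_iff.1 (Finset.mem_range.1 hk)

open Polynomial in
theorem qRacah_orthogonal {q a α β : ℝ} (P : RacahParams q (q ^ (2 * a)) (q ^ β) (q ^ α))
    {n N : ℕ} (hnN : n < N) (h : ℝ[X]) (hh : h.degree < n) :
    ∑ i ∈ Finset.range N, racahWeight q (q ^ (2 * a)) (q ^ β) (q ^ α) (q ^ N) i *
      (qRacah n N a α β q * h).eval (qQuadraticGrid q (a + i)) = 0 := by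
  set l : ℝ[X] →ₗ[ℝ] ℝ := ∑ i ∈ Finset.range N,
    racahWeight q (q ^ (2 * a)) (q ^ β) (q ^ α) (q ^ N) i •
      (leval (qQuadraticGrid q (a + i)) ∘ₗ LinearMap.mulLeft ℝ (qRacah n N a α β q)) with hl
  have hlapp : ∀ g, l g = ∑ i ∈ Finset.range N,
      racahWeight q (q ^ (2 * a)) (q ^ β) (q ^ α) (q ^ N) i *
        (qRacah n N a α β q * g).eval (qQuadraticGrid q (a + i)) := fun g => by
    simp [hl, leval]
  rw [← hlapp]
  refine eq_zero_of_degree_lt l (racahBasisPoly_natDegree P.q_pos a)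
    (racahBasisPoly_ne_zero P.q_pos a) (fun k hk => ?_) h hh
  rw [hlapp, ← P.orthogonal_basis hnN k hk]
  simp only [eval_mul, qRacah_eval_lattice P.q_pos, racahBasisPoly_eval P.q_pos]

open Polynomial in
theorem exists_qRacah_roots {q a α β : ℝ} (ha : 0 < a)
    (P : RacahParams q (q ^ (2 * a)) (q ^ β) (q ^ α)) {n N : ℕ} (hnN : n < N) :
    ∃ y : Fin n → ℝ, StrictMono y ∧
      ∃ c : ℝ, c ≠ 0 ∧ qRacah n N a α β q = C c * ∏ k, (X - C (y k)) := by
  obtain ⟨hdeg, hne⟩ := qRacah_natDegree P hnN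
  obtain ⟨y, hy, h⟩ := exists_strictMono_roots_of_orthogonal
    (strictMono_qQuadraticGrid P.q_pos P.q_lt ha).injective.injOn
    (fun i hi => P.weight_pos (Finset.mem_range.1 hi)) hne hdeg (by simpa using hnN)
    (qRacah_orthogonal P hnN)
  exact ⟨y, hy, _, leadingCoeff_ne_zero.2 hne, h⟩

open Polynomial in
theorem qRacah_root_lt {q a α₁ β₁ α₂ β₂ : ℝ} (ha : 0 < a)
    (P₁ : RacahParams q (q ^ (2 * a)) (q ^ β₁) (q ^ α₁))
    (P₂ : RacahParams q (q ^ (2 * a)) (q ^ β₂) (q ^ α₂)) {n N : ℕ} (hnN : n < N)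
    (h : ∀ i, i + 1 < N →
      racahUp q (q ^ (2 * a)) (q ^ β₁) (q ^ α₁) (q ^ N) (q ^ i) *
          racahDown q (q ^ (2 * a)) (q ^ β₂) (q ^ α₂) (q ^ N) (q ^ (i + 1)) <
        racahUp q (q ^ (2 * a)) (q ^ β₂) (q ^ α₂) (q ^ N) (q ^ i) *
          racahDown q (q ^ (2 * a)) (q ^ β₁) (q ^ α₁) (q ^ N) (q ^ (i + 1)))
    {c₁ c₂ : ℝ} (hc₁ : c₁ ≠ 0) (hc₂ : c₂ ≠ 0) {y₁ y₂ : Fin n → ℝ} (hy₁ : StrictMono y₁)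
    (hy₂ : StrictMono y₂) (h₁ : qRacah n N a α₁ β₁ q = C c₁ * ∏ k, (X - C (y₁ k)))
    (h₂ : qRacah n N a α₂ β₂ q = C c₂ * ∏ k, (X - C (y₂ k))) (k : Fin n) : y₁ k < y₂ k := by
  have hx := strictMono_qQuadraticGrid P₁.q_pos P₁.q_lt ha
  exact root_lt_root_of_ratio_lt hx.injective.injOn
    (fun i hi => P₁.weight_pos (Finset.mem_range.1 hi))
    (fun i hi => P₂.weight_pos (Finset.mem_range.1 hi))
    (fun i _ j hj hij => weight_cross_lt P₁ P₂ h (hx.lt_iff_lt.1 hij) (Finset.mem_range.1 hj))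
    (by simpa using hnN) hc₁ hc₂ hy₁ hy₂ h₁ h₂
    (qRacah_orthogonal P₁ hnN) (qRacah_orthogonal P₂ hnN) k
end

/-! ### Monotonicity of the zeros -/

theorem mainTheorem5 (q a : ℝ) (hq0 : 0 < q) (hq1 : q < 1) (ha : 0 < a)
    (n N : ℕ) (hn : 1 ≤ n) (hnN : n < N) :
    ∃ Y : Fin n → ℝ → ℝ → ℝ,
      -- `Y 0 α β < ⋯ < Y (n - 1) α β` are the zeros of the polynomial, all real and simple
      (∀ α β : ℝ, -1 < α → -1 < β → β < 2 * a →
        StrictMono (fun k => Y k α β) ∧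
        ∃ c : ℝ, c ≠ 0 ∧
          qRacah n N a α β q =
            Polynomial.C c * ∏ k : Fin n, (Polynomial.X - Polynomial.C (Y k α β))) ∧
      (1 / 2 ≤ a → ∀ k : Fin n,
        (∀ β ∈ Set.Ioo (-1) (2 * a), StrictAntiOn (fun α => Y k α β) (Set.Ioi (-1))) ∧
        (∀ α ∈ Set.Ioi (-1 : ℝ), StrictMonoOn (fun β => Y k α β) (Set.Ioo (-1) (2 * a)))) ∧
      (a < 1 / 2 → ∀ k : Fin n,
        (∀ β ∈ Set.Ioo (a - 1 / 2) (2 * a),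
          StrictAntiOn (fun α => Y k α β) (Set.Ioi (-1))) ∧
        (∀ α ∈ Set.Ioi (-1 : ℝ),
          StrictMonoOn (fun β => Y k α β) (Set.Ioo (a - 1 / 2) (2 * a)))) := by
  -- Outside the parameter region the value of `y` is arbitrary, so that the zeros can be chosen as
  -- total functions of α and β.
  have hex : ∀ α β : ℝ, ∃ y : Fin n → ℝ, -1 < α → -1 < β → β < 2 * a → StrictMono y ∧
      ∃ c : ℝ, c ≠ 0 ∧ qRacah n N a α β q =
        Polynomial.C c * ∏ k : Fin n, (Polynomial.X - Polynomial.C (y k)) := by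
    intro α β
    by_cases h : -1 < α ∧ -1 < β ∧ β < 2 * a
    · obtain ⟨y, hy⟩ := exists_qRacah_roots ha
        (racahParams_of_exponents hq0 hq1 ha h.1 h.2.1 h.2.2) hnN
      exact ⟨y, fun _ _ _ => hy⟩
    · exact ⟨0, fun h1 h2 h3 => absurd ⟨h1, h2, h3⟩ h⟩
  choose Y hY using hex
  have hanti : ∀ k, ∀ β ∈ Set.Ioo (-1) (2 * a),
      StrictAntiOn (fun α => Y α β k) (Set.Ioi (-1)) := by
    intro k β hβ α₁ hα₁ α₂ hα₂ hlt
    obtain ⟨hy₁, c₁, hc₁, h₁⟩ := hY α₁ β hα₁ hβ.1 hβ.2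
    obtain ⟨hy₂, c₂, hc₂, h₂⟩ := hY α₂ β hα₂ hβ.1 hβ.2
    have P₁ := racahParams_of_exponents hq0 hq1 ha hα₁ hβ.1 hβ.2
    have P₂ := racahParams_of_exponents hq0 hq1 ha hα₂ hβ.1 hβ.2
    -- α₁ < α₂ means q^{α₂} < q^{α₁}, hence the exchanged roles.
    exact qRacah_root_lt ha P₂ P₁ hnN (fun i hi => cross_lt_of_b_lt P₂
      (Real.rpow_lt_rpow_of_exponent_gt hq0 hq1 hlt) hi) hc₂ hc₁ hy₂ hy₁ h₂ h₁ k
  have hmono : ∀ k, ∀ α ∈ Set.Ioi (-1 : ℝ),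
      StrictMonoOn (fun β => Y α β k) (Set.Ioo (-1) (2 * a)) := by
    intro k α hα β₁ hβ₁ β₂ hβ₂ hlt
    obtain ⟨hy₁, c₁, hc₁, h₁⟩ := hY α β₁ hα hβ₁.1 hβ₁.2
    obtain ⟨hy₂, c₂, hc₂, h₂⟩ := hY α β₂ hα hβ₂.1 hβ₂.2
    have P₁ := racahParams_of_exponents hq0 hq1 ha hα hβ₁.1 hβ₁.2
    have P₂ := racahParams_of_exponents hq0 hq1 ha hα hβ₂.1 hβ₂.2
    exact qRacah_root_lt ha P₁ P₂ hnN (fun i hi => cross_lt_of_A_lt P₁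
      (Real.rpow_lt_rpow_of_exponent_gt hq0 hq1 hlt) hi) hc₁ hc₂ hy₁ hy₂ h₁ h₂ k
  -- As a > 0, the interval of case (ii) lies in (-1, 2a), where monotonicity is already known.
  have hsub : Set.Ioo (a - 1 / 2) (2 * a) ⊆ Set.Ioo (-1) (2 * a) :=
    Set.Ioo_subset_Ioo_left (by linarith)
  exact ⟨fun k α β => Y α β k, hY, fun _ k => ⟨hanti k, hmono k⟩,
    fun _ k => ⟨fun β hβ => hanti k β (hsub hβ), fun α hα => (hmono k α hα).mono hsub⟩⟩
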